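/- Let $G$ be a finite directed acyclic graph whose nodes are variables with finitely many states, with a conditional probability table $P(v\mid \mathrm{pa}(v))$ for every node $v$, where $\mathrm{pa}(v)$ are the parents of $v$. Let $P=\prod_v P(v\mid \mathrm{pa}(v))$ be the resulting joint distribution. For a node $X$ and a state $x$ of it, let $P(\cdot\mid do(x))$ be the distribution obtained by deleting the factor of $X$ from this product and setting $X=x$. A path (a sequence of distinct nodes, consecutive ones being joined by an arrow in either direction) is blocked by a set $Z$ of nodes if it contains a chain $A\to B\to C$ or a fork $A\leftarrow B\to C$ (with $A,B,C$ consecutive on the path, in either order) with $B\in Z$, or a collider $A\to B\leftarrow C$ such that neither $B$ nor any descendant of $B$ is in $Z$. The set $Z$ satisfies the back-door criterion relative to $(X,Y)$ if no node of $Z$ is $X$ or a descendant of $X$, and $Z$ blocks every path between $X$ and $Y$ that contains an arrow into $X$. Let $X\neq Y$ be nodes and let $W,U$ be sets of nodes such that $W\cup U$ satisfies the back-door criterion relative to $(X,Y)$. Fix states $x$ of $X$ and $y$ of $Y$, and suppose that $P(x,w,u)>0$ for all values $w$ of $W$ and $u$ of $U$ with $P(w,u)>0$. Given only the tables $P(X,Y,W)$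 and $P(U)$, consider real variables $a_{w,u},b_{w,u},c_{w,u}$ (one triple for every value $w$ of $W$ and $u$ of $U$) subject to $$\sum_u a_{w,u}=P(x,y,w),\qquad \sum_u b_{w,u}=P(w),\qquad \sum_u c_{w,u}=P(x,w)\qquad\text{for all } w,$$ and, for all $w$ and $u$, $$b_{w,u}\ge c_{w,u}\ge a_{w,u},$$ $$\max\{0,P(x,y,w)+P(u)-1\}\le a_{w,u}\le\min\{P(x,y,w),P(u)\},$$ $$\max\{0,P(w)+P(u)-1\}\le b_{w,u}\le\min\{P(w),P(u)\},$$ $$\max\{0,P(x,w)+P(u)-1\}\le c_{w,u}\le\min\{P(x,w),P(u)\}.$$ Let $\mathrm{LB}$ and $\mathrm{UB}$ be the infimum and the supremum (the minimum and the maximum when attained) of $$\sum_{w,u}\frac{a_{w,u}\,b_{w,u}}{c_{w,u}}$$ over all such points at which this objective is defined, i.e. at which $c_{w,u}=0$ only where $b_{w,u}=0$; a term with $a_{w,u}=b_{w,u}=c_{w,u}=0$ counts as $0$. Then the set of these points is nonempty, the objective is bounded on it, and $$\mathrm{LB}\le P(y\mid do(x))\le \mathrm{UB}.$$ -/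

import Mathlib

open Finset

/-! Causal diagrams, paths, blocking and the back-door criterion. -/

/-- A directed graph is acyclic if no node can be reached from itself by a nontrivial directed
path. -/
def Digraph.IsAcyclicDigraph {V : Type*} (G : Digraph V) : Prop :=
  ∀ v, ¬ Relation.TransGen G.Adj v v

/-- `D` is a descendant of `B` (every node is a descendant of itself). -/
def Digraph.IsDescendant {V : Type*} (G : Digraph V) (B D : V) : Prop :=
  Relation.ReflTransGen G.Adj B D

/-- `p` is a path between `A` and `B`: a list of distinct nodes from `A` to `B`, any two
consecutive nodes being joined by an arrow in one of the two directions. In an acyclic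
graph the nodes determine the arrows. -/
structure Digraph.IsPath {V : Type*} (G : Digraph V) (A B : V) (p : List V) : Prop where
  chain : p.IsChain (fun u v => G.Adj u v ∨ G.Adj v u)
  nodup : p.Nodup
  head : p.head? = some A
  last : p.getLast? = some B

/-- The path `p` is blocked by `Z`: it contains a chain or a fork whose middle node is in `Z`,
or a collider such that neither the collision node nor any of its descendants is in `Z`. -/
def Digraph.IsBlocked {V : Type*} (G : Digraph V) (Z : Finset V) (p : List V) : Prop :=
  ∃ A B C, [A, B, C] <:+: p ∧
    ((((G.Adj A B ∧ G.Adj B C) ∨ (G.Adj C B ∧ G.Adj B A) ∨ (G.Adj B A ∧ G.Adj B C)) ∧ B ∈ Z) ∨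
      ((G.Adj A B ∧ G.Adj C B) ∧ ∀ D, G.IsDescendant B D → D ∉ Z))

/-- The back-door criterion for `Z` relative to the ordered pair `(X, Y)`: no node of `Z` is a
descendant of `X`, and `Z` blocks every path between `X` and `Y` that contains an arrow
into `X`. -/
structure Digraph.BackDoor {V : Type*} (G : Digraph V) (X Y : V) (Z : Finset V) : Prop where
  not_descendant : ∀ v ∈ Z, ¬ G.IsDescendant X v
  blocked : ∀ p, G.IsPath X Y p → (∃ A, [X, A] <+: p ∧ G.Adj A X) → G.IsBlocked Z p

/-! Distributions compatible with a causal diagram, and interventions. -/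

/-- A causal model on the diagram `G` with finite state spaces `S v`: for every node `v` a
conditional probability table `P(v | parents of v)`. -/
structure CausalModel {V : Type*} (G : Digraph V) (S : V → Type*) [∀ v, Fintype (S v)] where
  cpt : ∀ v, (∀ u : {u // G.Adj u v}, S u) → S v → ℝ
  cpt_nonneg : ∀ v pa s, 0 ≤ cpt v pa s
  cpt_sum : ∀ v pa, ∑ s, cpt v pa s = 1

namespace CausalModel

variable {V : Type*} [Fintype V] [DecidableEq V] {G : Digraph V} {S : V → Type*}
  [∀ v, Fintype (S v)]

/-- The factor `P(v | parents of v)` at the joint assignment `ω`. -/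
def factor (M : CausalModel G S) (v : V) (ω : ∀ v, S v) : ℝ :=
  M.cpt v (fun u => ω u) (ω v)

/-- The joint distribution compatible with `G`: the product of all factors. -/
def joint (M : CausalModel G S) (ω : ∀ v, S v) : ℝ :=
  ∏ v, M.factor v ω

/-- The post-intervention distribution under `do(X = x)`: the truncated factorization, in which
the factor of `X` is deleted and `X` is set to `x`. -/
noncomputable def doJoint (M : CausalModel G S) (X : V) (x : S X) (ω : ∀ v, S v) : ℝ :=
  {ω : ∀ v, S v | ω X = x}.indicator (fun ω => ∏ v ∈ univ.erase X, M.factor v ω) ω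

/-- The probability of the event `E` in the observational distribution. -/
noncomputable def prob (M : CausalModel G S) (E : Set (∀ v, S v)) : ℝ :=
  ∑ ω, E.indicator M.joint ω

/-- The probability of the event `E` under the intervention `do(X = x)`. -/
noncomputable def doProb (M : CausalModel G S) (X : V) (x : S X) (E : Set (∀ v, S v)) : ℝ :=
  ∑ ω, E.indicator (M.doJoint X x) ω

/-- The causal effect `P(y | do(x))`. -/
noncomputable def causalEffect (M : CausalModel G S) (X Y : V) (x : S X) (y : S Y) : ℝ :=
  M.doProb X x {ω | ω Y = y}

/-- The observed table `P(X, Y, W)`. -/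
noncomputable def tableXYW (M : CausalModel G S) (X Y : V) (W : Finset V)
    (x : S X) (y : S Y) (w : ∀ v : W, S v) : ℝ :=
  M.prob {ω | ω X = x ∧ ω Y = y ∧ W.restrict ω = w}

/-- The observed table `P(U)`. -/
noncomputable def tableU (M : CausalModel G S) (U : Finset V) (u : ∀ v : U, S v) : ℝ :=
  M.prob {ω | U.restrict ω = u}

end CausalModel

/-! The optimization problem. It is a function of the two tables `q = P(X, Y, W)` and `r = P(U)`
only. Here `𝒳`, `𝒴`, `𝒲`, `𝒰` are the sets of values of `X`, `Y`, `W`, `U`. -/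

/-- The constraints on the variables `a`, `b`, `c`. The marginals `P(w)` and `P(x, w)` are
computed from the table `q`. -/
structure IsFeasible {𝒳 𝒴 𝒲 𝒰 : Type*} [Fintype 𝒳] [Fintype 𝒴] [Fintype 𝒰]
    (q : 𝒳 → 𝒴 → 𝒲 → ℝ) (r : 𝒰 → ℝ) (x : 𝒳) (y : 𝒴) (a b c : 𝒲 → 𝒰 → ℝ) : Prop where
  sum_a : ∀ w, ∑ u, a w u = q x y w
  sum_b : ∀ w, ∑ u, b w u = ∑ x', ∑ y', q x' y' w
  sum_c : ∀ w, ∑ u, c w u = ∑ y', q x y' w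
  c_le_b : ∀ w u, c w u ≤ b w u
  a_le_c : ∀ w u, a w u ≤ c w u
  le_a : ∀ w u, max 0 (q x y w + r u - 1) ≤ a w u
  a_le : ∀ w u, a w u ≤ min (q x y w) (r u)
  le_b : ∀ w u, max 0 ((∑ x', ∑ y', q x' y' w) + r u - 1) ≤ b w u
  b_le : ∀ w u, b w u ≤ min (∑ x', ∑ y', q x' y' w) (r u)
  le_c : ∀ w u, max 0 ((∑ y', q x y' w) + r u - 1) ≤ c w u
  c_le : ∀ w u, c w u ≤ min (∑ y', q x y' w) (r u)

/-- The set of values of the objective `∑ a b / c` over the feasible points at which it is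
defined. A term with `c = 0 < b` is undefined (`0 / 0`), and such points are left out; a term
with `b = 0`, hence `a = c = 0`, stands for `P(y | x, w, u) * 0` and counts as `0`. -/
def objectiveValues {𝒳 𝒴 𝒲 𝒰 : Type*} [Fintype 𝒳] [Fintype 𝒴] [Fintype 𝒲] [Fintype 𝒰]
    (q : 𝒳 → 𝒴 → 𝒲 → ℝ) (r : 𝒰 → ℝ) (x : 𝒳) (y : 𝒴) : Set ℝ :=
  {t | ∃ a b c : 𝒲 → 𝒰 → ℝ, IsFeasible q r x y a b c ∧ (∀ w u, c w u = 0 → b w u = 0) ∧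
    t = ∑ w, ∑ u, a w u * b w u / c w u}

/-! The causal effect is itself a value of the objective, so it lies between the infimum and the
supremum as soon as the values are bounded. Take the true probabilities P(x,y,w,u), P(w,u), P(x,w,u)
for a, b, c: the constraints are marginalization, monotonicity and the Fréchet bounds
(`isFeasible_prob`), and the objective becomes the back-door adjustment formula
(`sum_adjustment_eq_causalEffect`). Boundedness holds because 0 ≤ a ≤ c gives 0 ≤ ab/c ≤ b.

The work lies in deriving the adjustment formula from the path criterion. In a severed model, X
keeps its own factor but its children see the constant x. This model agrees with P where X = x and
on events about nondescendants of X, and with P(· | do(x)) on events that do not involve X. In it X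
and Y are independent given Z = W ∪ U (`eventWeight_severed_mul`), which translates into P(y,z |
do(x)) P(x,z) = P(x,y,z) P(z).

This independence is d-separation in the graph without the arrows out of X. The factors outside the
ancestral set of X, Y and Z are summed out. Let R be the set of nodes outside Z that active trails
from X reach. Each remaining family lies in R ∪ Z or misses R, so exchanging the R-coordinates of
two assignments that agree on Z preserves the product of their weights (`eventWeight_inter_mul`). Y
is not in R, since an active trail to Y would shorten to an unblocked back-door path
(`ActiveReach.exists_path`, `ActivePath.not_isBlocked`). -/

/-! ### Active trails

A trail that starts at `X` is recorded by its last node together with the mark that its last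
arrow carries at that node. -/

/-- The mark of an arrow at one of its two ends. -/
inductive ArrowMark
  | tail
  | head

section ActiveTrails

variable {V : Type*} {r : V → V → Prop} {Z : Finset V} {X Y : V}

/-- `v` has a descendant in `Z`. -/
def HasDescendantIn (r : V → V → Prop) (Z : Finset V) (v : V) : Prop :=
  ∃ D ∈ Z, Relation.ReflTransGen r v D

/-- The steps by which an active trail may be prolonged. -/
inductive ActiveStep (r : V → V → Prop) (Z : Finset V) : V → ArrowMark → V → ArrowMark → Prop
  | up_of_tail {v w : V} : r w v → v ∉ Z → ActiveStep r Z v .tail w .tail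
  | up_of_head {v w : V} : r w v → HasDescendantIn r Z v → ActiveStep r Z v .head w .tail
  | down {v : V} {m : ArrowMark} {w : V} : r v w → v ∉ Z → ActiveStep r Z v m w .head

/-- Some active trail from `X` ends in the given node with the given mark. -/
inductive ActiveReach (r : V → V → Prop) (Z : Finset V) (X : V) : V → ArrowMark → Prop
  | start : ActiveReach r Z X X .tail
  | step {v m w n} : ActiveReach r Z X v m → ActiveStep r Z v m w n → ActiveReach r Z X w n

/-- The list is an active trail from `X` without repeated nodes, its last node coming first. -/
inductive ActivePath (r : V → V → Prop) (Z : Finset V) (X : V) : V → ArrowMark → List V → Prop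
  | start : ActivePath r Z X X .tail [X]
  | step {v m l w n} : ActivePath r Z X v m l → w ∉ l → ActiveStep r Z v m w n →
      ActivePath r Z X w n (w :: l)

theorem HasDescendantIn.of_mem {v : V} (h : v ∈ Z) : HasDescendantIn r Z v := ⟨v, h, .refl⟩

theorem HasDescendantIn.of_reflTransGen {v w : V} (h : HasDescendantIn r Z w)
    (hvw : Relation.ReflTransGen r v w) : HasDescendantIn r Z v :=
  let ⟨D, hD, hw⟩ := h
  ⟨D, hD, hvw.trans hw⟩

/-- Cutting an active path at one of its nodes. -/
theorem ActivePath.exists_prefix {v : V} {m : ArrowMark} {l : List V}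
    (h : ActivePath r Z X v m l) {w : V} (hw : w ∈ l) :
    ∃ n l', ActivePath r Z X w n l' ∧ ((w = v ∧ n = m) ∨ ((n = .tail → w ∉ Z) ∧
      (n = .head → HasDescendantIn r Z w ∨ (m = .head ∧ Relation.ReflTransGen r w v)))) := by
  induction h with
  | start =>
    obtain rfl : w = X := by simpa using hw
    exact ⟨_, _, .start, .inl ⟨rfl, rfl⟩⟩
  | @step v m l v' m' h hv' hs ih =>
    rcases List.mem_cons.1 hw with rfl | hw
    · exact ⟨_, _, .step h hv' hs, .inl ⟨rfl, rfl⟩⟩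
    obtain ⟨n, l', hp, hn⟩ := ih hw
    refine ⟨n, l', hp, .inr ?_⟩
    -- After leaving `w` along an arrow, the path runs forward until its first step against an
    -- arrow. That step is taken at a collider with a descendant in `Z`, which is then a descendant
    -- of `w` too.
    rcases hn with ⟨rfl, rfl⟩ | ⟨hn, hn'⟩
    · cases hs with
      | up_of_tail _ hZ => exact ⟨fun _ => hZ, by simp⟩
      | up_of_head _ hZ => exact ⟨by simp, fun _ => .inl hZ⟩
      | down hr hZ => exact ⟨fun _ => hZ, fun _ => .inr ⟨rfl, .single hr⟩⟩
    · refine ⟨hn, fun hh => ?_⟩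
      rcases hn' hh with hZ | ⟨rfl, hd⟩
      · exact .inl hZ
      · cases hs with
        | up_of_head _ hZ => exact .inl (hZ.of_reflTransGen hd)
        | down hr _ => exact .inr ⟨rfl, hd.tail hr⟩

/-- An active trail can be shortened to an active path. -/
theorem ActiveReach.exists_path (hr : ∀ v, ¬ r v v) {v : V} {m : ArrowMark}
    (h : ActiveReach r Z X v m) :
    ∃ n l, ActivePath r Z X v n l ∧ (m = .tail → n = .tail ∨ HasDescendantIn r Z v) ∧
      (m = .head → n = .head ∨ v ∉ Z) := by
  induction h with
  | start => exact ⟨_, _, .start, fun _ => .inl rfl, by simp⟩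
  | @step v m w n h hs ih =>
    obtain ⟨m', l, hp, h₁, h₂⟩ := ih
    -- The path may reach `v` with another mark than the trail, but the invariant then supplies
    -- exactly the condition that the step needs from the new mark.
    have hs' : ActiveStep r Z v m' w n := by
      cases hs with
      | up_of_tail hwv hZ =>
        cases m' with
        | tail => exact .up_of_tail hwv hZ
        | head => exact .up_of_head hwv (by simpa using h₁ rfl)
      | up_of_head hwv hZ =>
        cases m' with
        | tail => exact .up_of_tail hwv (by simpa using h₂ rfl)
        | head => exact .up_of_head hwv hZ
      | down hvw hZ => exact .down hvw hZ
    by_cases hw : w ∈ l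
    · obtain ⟨n', l', hp', hn⟩ := hp.exists_prefix hw
      rcases hn with ⟨rfl, rfl⟩ | ⟨hn, hn'⟩
      · cases hs' with
        | up_of_tail h _ => exact (hr _ h).elim
        | up_of_head h _ => exact (hr _ h).elim
        | down h _ => exact (hr _ h).elim
      · refine ⟨n', l', hp', ?_, ?_⟩
        · rintro rfl
          cases n' with
          | tail => exact .inl rfl
          | head =>
            rcases hn' rfl with hZ | ⟨rfl, -⟩
            · exact .inr hZ
            · cases hs' with
              | up_of_head hwv hZ => exact .inr (hZ.of_reflTransGen (.single hwv))
        · rintro -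
          cases n' with
          | tail => exact .inr (hn rfl)
          | head => exact .inl rfl
    · exact ⟨n, w :: l, .step hp hw hs', .inl, .inl⟩

/-! ### Active paths as unblocked back-door paths -/

theorem ActiveStep.adj {v w : V} {m n : ArrowMark} (h : ActiveStep r Z v m w n) :
    (n = .tail ∧ r w v) ∨ (n = .head ∧ r v w) := by
  cases h <;> simp_all

theorem ActivePath.nodup {v : V} {m : ArrowMark} {l : List V} (h : ActivePath r Z X v m l) :
    l.Nodup := by
  induction h with
  | start => simp
  | step _ hw _ ih => exact List.nodup_cons.2 ⟨hw, ih⟩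

theorem ActivePath.head?_eq {v : V} {m : ArrowMark} {l : List V} (h : ActivePath r Z X v m l) :
    l.head? = some v := by
  cases h <;> rfl

theorem ActivePath.getLast?_eq {v : V} {m : ArrowMark} {l : List V}
    (h : ActivePath r Z X v m l) : l.getLast? = some X := by
  induction h with
  | start => rfl
  | step _ _ _ ih => simp [List.getLast?_cons, ih]

theorem ActivePath.isChain {v : V} {m : ArrowMark} {l : List V} (h : ActivePath r Z X v m l) :
    l.IsChain (fun u v => r u v ∨ r v u) := by
  induction h with
  | start => simp
  | step h _ hs ih =>
    refine List.isChain_cons.2 ⟨fun u hu => ?_, ih⟩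
    obtain rfl : _ = u := by simpa [h.head?_eq] using hu
    rcases hs.adj with h | h
    · exact .inl h.2
    · exact .inr h.2

/-- Since no arrow leaves `X`, the first step can only go against an arrow into `X`; this makes the
path a back-door path. The start of the path is the end of the list. -/
theorem ActivePath.suffix_of_ne {v : V} {m : ArrowMark} {l : List V}
    (hX : ∀ v, ¬ r X v) (h : ActivePath r Z X v m l) :
    (v = X ∧ l = [X]) ∨ ∃ A, [A, X] <:+ l ∧ r A X := by
  induction h with
  | start => exact .inl ⟨rfl, rfl⟩
  | @step v m l w n h _ hs ih =>
    right
    rcases ih with ⟨rfl, rfl⟩ | ⟨A, hA, hr⟩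
    · exact ⟨w, List.suffix_refl _, hs.adj.elim (·.2) fun h => (hX _ h.2).elim⟩
    · exact ⟨A, hA.trans (List.suffix_cons _ _), hr⟩

theorem ActivePath.second {v u : V} {m : ArrowMark} {l : List V}
    (h : ActivePath r Z X v m (v :: u :: l)) : (m = .tail ∧ r v u) ∨ (m = .head ∧ r u v) := by
  cases h with
  | step h _ hs =>
    obtain rfl := by simpa using h.head?_eq
    exact hs.adj

/-- Each step of the path negates the blocking condition at the node it leaves. Acyclicity fixes the
direction of every arrow, so a triple cannot be read both as a collider and as a chain or fork. -/
theorem ActivePath.not_isBlocked {G : Digraph V} (hG : G.IsAcyclicDigraph)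
    (hrG : ∀ a b, r a b → G.Adj a b) {v : V} {m : ArrowMark} {l : List V}
    (h : ActivePath r Z X v m l) : ¬ G.IsBlocked Z l := by
  have anti : ∀ a b, G.Adj a b → r b a → False := fun a b h h' =>
    hG a (.tail (.single h) (hrG _ _ h'))
  induction h with
  | start =>
    rintro ⟨A, B, C, hi, -⟩
    simpa using hi.length_le
  | @step v m l w n h _ hs ih =>
    rintro ⟨A, B, C, hi, hb⟩
    rcases List.infix_cons_iff.1 hi with hp | hi
    · obtain ⟨t, ht⟩ := hp
      simp only [List.cons_append, List.nil_append, List.cons.injEq] at ht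
      obtain ⟨rfl, rfl⟩ := ht
      obtain rfl : B = v := by simpa using h.head?_eq
      have h2 := h.second
      cases hs with
      | up_of_tail hr hZ =>
        have := h2.resolve_right (by simp)
        rcases hb with hb | hb
        · exact hZ hb.2
        · exact anti _ _ hb.1.2 this.2
      | up_of_head hr hZ =>
        have := h2.resolve_left (by simp)
        rcases hb with ⟨⟨-, h⟩ | ⟨-, h⟩ | ⟨-, h⟩, -⟩ | hb
        · exact anti _ _ h this.2
        · exact anti _ _ h hr
        · exact anti _ _ h this.2
        · obtain ⟨D, hD, hBD⟩ := hZ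
          exact hb.2 D (hBD.lift id hrG) hD
      | down hr hZ =>
        rcases hb with hb | hb
        · exact hZ hb.2
        · exact anti _ _ hb.1.1 hr
    · exact ih ⟨A, B, C, hi, hb⟩

theorem Digraph.IsBlocked.reverse {G : Digraph V} {p : List V} (h : G.IsBlocked Z p.reverse) :
    G.IsBlocked Z p := by
  obtain ⟨A, B, C, hi, hb⟩ := h
  refine ⟨C, B, A, by simpa using List.reverse_infix.2 hi, ?_⟩
  tauto

/-- Under the back-door criterion, no active trail that avoids the arrows out of `X` leads from
`X` to `Y`. -/
theorem Digraph.BackDoor.not_activeReach {G : Digraph V} (hG : G.IsAcyclicDigraph) (hXY : X ≠ Y)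
    (hZ : G.BackDoor X Y Z) (m : ArrowMark) :
    ¬ ActiveReach (fun a b => G.Adj a b ∧ a ≠ X) Z X Y m := by
  intro h
  obtain ⟨n, l, hp, -, -⟩ := h.exists_path fun v hv => hG v (.single hv.1)
  refine hp.not_isBlocked hG (fun _ _ h => h.1) (Digraph.IsBlocked.reverse ?_)
  refine hZ.blocked l.reverse ⟨?_, ?_, ?_, ?_⟩ ?_
  · rw [List.isChain_reverse]
    exact hp.isChain.imp fun a b h => h.elim (.inr ·.1) (.inl ·.1)
  · exact List.nodup_reverse.2 hp.nodup
  · rw [List.head?_reverse, hp.getLast?_eq]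
  · rw [List.getLast?_reverse, hp.head?_eq]
  · rcases hp.suffix_of_ne (fun v h => h.2 rfl) with h | ⟨A, hA, hr⟩
    · exact (hXY h.1.symm).elim
    · exact ⟨A, by simpa using List.reverse_prefix.2 hA, hr.1⟩

/-- No node on the directed path is in `Z`, and a forward step asks for nothing else. -/
theorem ActiveReach.descend {v w : V} {m : ArrowMark} (h : ActiveReach r Z X v m)
    (hvw : Relation.ReflTransGen r v w) (hv : ¬ HasDescendantIn r Z v) :
    ∃ n, ActiveReach r Z X w n := by
  induction hvw with
  | refl => exact ⟨m, h⟩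
  | @tail b c hb hbc ih =>
    obtain ⟨n, hn⟩ := ih
    exact ⟨_, .step hn (.down hbc fun hZ => hv ⟨b, hZ, hb⟩)⟩

theorem ActiveReach.ascend {v : V} (hv : Relation.ReflTransGen r v X)
    (hZ : ¬ HasDescendantIn r Z v) : ActiveReach r Z X v .tail := by
  induction hv using Relation.ReflTransGen.head_induction_on with
  | refl => exact .start
  | @head a b hab _ ih =>
    have hb : ¬ HasDescendantIn r Z b := fun h => hZ (h.of_reflTransGen (.single hab))
    exact .step (ih hb) (.up_of_tail hab fun h => hb (.of_mem h))

/-- The nodes outside `Z` that active trails from `X` reach. -/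
def activeSet (r : V → V → Prop) (Z : Finset V) (X : V) : Set V :=
  {v | v ∉ Z ∧ ∃ m, ActiveReach r Z X v m}

/-- A family (a node and its parents) inside the ancestral set of `X`, `Y` and `Z` does not
separate the reached nodes from the other nodes outside `Z`. -/
theorem family_subset_or_disjoint_activeSet (hY : ∀ m, ¬ ActiveReach r Z X Y m) {c : V}
    (hc : HasDescendantIn r Z c ∨ Relation.ReflTransGen r c X ∨ Relation.ReflTransGen r c Y) :
    (∀ i, (i = c ∨ r i c) → i ∈ activeSet r Z X ∨ i ∈ Z) ∨
      (∀ i, (i = c ∨ r i c) → i ∉ activeSet r Z X) := by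
  have of_tail : c ∉ Z → ActiveReach r Z X c .tail →
      ∀ i, (i = c ∨ r i c) → i ∈ activeSet r Z X ∨ i ∈ Z := by
    rintro hcZ hR i (rfl | hi)
    · exact .inl ⟨hcZ, _, hR⟩
    · exact or_iff_not_imp_right.2 fun hiZ => ⟨hiZ, _, .step hR (.up_of_tail hi hcZ)⟩
  have of_head : ActiveReach r Z X c .head →
      ∀ i, (i = c ∨ r i c) → i ∈ activeSet r Z X ∨ i ∈ Z := by
    intro hR
    by_cases hcZ : HasDescendantIn r Z c
    · rintro i (rfl | hi)
      · exact or_iff_not_imp_right.2 fun hiZ => ⟨hiZ, _, hR⟩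
      · exact or_iff_not_imp_right.2 fun hiZ => ⟨hiZ, _, .step hR (.up_of_head hi hcZ)⟩
    -- A closed collider in the ancestral set is an ancestor of `X` or of `Y`. In the first case a
    -- trail climbing from `X` reaches it with a tail instead; in the second the trail could descend
    -- to `Y`.
    · rcases hc with hc | hc | hc
      · exact (hcZ hc).elim
      · exact of_tail (fun h => hcZ (.of_mem h)) (.ascend hc hcZ)
      · obtain ⟨n, hn⟩ := hR.descend hc hcZ
        exact (hY n hn).elim
  by_cases h : ∃ i, (i = c ∨ r i c) ∧ i ∈ activeSet r Z X
  · left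
    obtain ⟨i, rfl | hi, hiZ, m, hR⟩ := h
    · cases m with
      | tail => exact of_tail hiZ hR
      | head => exact of_head hR
    · exact of_head (.step hR (.down hi hiZ))
  · exact .inr fun i hi hm => h ⟨i, hi, hm⟩

end ActiveTrails

/-! ### Sums over joint assignments -/

section Weights

variable {Ω : Type*} [Fintype Ω]

/-- The total weight of the event `E`. -/
noncomputable def eventWeight (p : Ω → ℝ) (E : Set Ω) : ℝ :=
  ∑ ω, E.indicator p ω

variable {p : Ω → ℝ}

theorem eventWeight_mono (hp : ∀ ω, 0 ≤ p ω) {E F : Set Ω} (h : E ⊆ F) :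
    eventWeight p E ≤ eventWeight p F :=
  sum_le_sum fun ω _ => Set.indicator_le_indicator_of_subset h hp ω

theorem eventWeight_nonneg (hp : ∀ ω, 0 ≤ p ω) (E : Set Ω) : 0 ≤ eventWeight p E :=
  sum_nonneg fun ω _ => Set.indicator_nonneg (fun ω _ => hp ω) ω

theorem sum_eventWeight_inter {ι : Type*} [Fintype ι] (E : Set Ω) (g : Ω → ι) :
    ∑ i, eventWeight p (E ∩ {ω | g ω = i}) = eventWeight p E := by
  classical
  unfold eventWeight
  rw [sum_comm]
  refine sum_congr rfl fun ω _ => ?_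
  rw [sum_eq_single (g ω)]
  · simp [Set.indicator_apply]
  · intro i _ hi
    simp [hi.symm]
  · simp

/-- The Fréchet lower bound. -/
theorem le_eventWeight_inter (hp : ∀ ω, 0 ≤ p ω) (hp1 : eventWeight p Set.univ ≤ 1)
    (E F : Set Ω) :
    max 0 (eventWeight p E + eventWeight p F - 1) ≤ eventWeight p (E ∩ F) := by
  refine max_le (eventWeight_nonneg hp _) ?_
  have h : eventWeight p E + eventWeight p F =
      eventWeight p (E ∪ F) + eventWeight p (E ∩ F) := by
    simp only [eventWeight, ← sum_add_distrib]
    refine sum_congr rfl fun ω _ => ?_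
    have := congrFun (Set.indicator_union_add_inter p E F) ω
    simpa using this.symm
  have := eventWeight_mono hp (Set.subset_univ (E ∪ F))
  linarith

/-- The Fréchet upper bound. -/
theorem eventWeight_inter_le (hp : ∀ ω, 0 ≤ p ω) (E F : Set Ω) :
    eventWeight p (E ∩ F) ≤ min (eventWeight p E) (eventWeight p F) :=
  le_min (eventWeight_mono hp Set.inter_subset_left) (eventWeight_mono hp Set.inter_subset_right)

theorem eventWeight_eq_sum_mul (p : Ω → ℝ) (E : Set Ω) :
    eventWeight p E = ∑ ω, E.indicator 1 ω * p ω := by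
  classical
  simp [eventWeight, Set.indicator_apply]

end Weights

/-- The event `E` is determined by the coordinates in `A`. -/
def DependsOnNodes {V : Type*} {S : V → Type*} (E : Set (∀ v, S v)) (A : Set V) : Prop :=
  ∀ ω ω' : ∀ v, S v, (∀ v ∈ A, ω v = ω' v) → ω ∈ E → ω' ∈ E

theorem DependsOnNodes.mono {V : Type*} {S : V → Type*} {E : Set (∀ v, S v)} {A B : Set V}
    (hE : DependsOnNodes E A) (h : A ⊆ B) : DependsOnNodes E B :=
  fun ω ω' hω => hE ω ω' fun v hv => hω v (h hv)

theorem DependsOnNodes.inter {V : Type*} {S : V → Type*} {E F : Set (∀ v, S v)} {A : Set V}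
    (hE : DependsOnNodes E A) (hF : DependsOnNodes F A) : DependsOnNodes (E ∩ F) A :=
  fun ω ω' hω h => ⟨hE ω ω' hω h.1, hF ω ω' hω h.2⟩

theorem dependsOnNodes_eval {V : Type*} {S : V → Type*} {v : V} (s : S v) {A : Set V}
    (hv : v ∈ A) : DependsOnNodes {ω : ∀ v, S v | ω v = s} A :=
  fun _ _ hω h => (hω v hv).symm.trans h

theorem indicator_update_eq {V : Type*} [DecidableEq V] {S : V → Type*} {E : Set (∀ v, S v)}
    {A : Set V}
    (hE : DependsOnNodes E A) {v : V} (hv : v ∉ A) (ω : ∀ v, S v) (s : S v) :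
    E.indicator (1 : (∀ v, S v) → ℝ) (Function.update ω v s) = E.indicator 1 ω := by
  have h : ∀ i ∈ A, Function.update ω v s i = ω i := fun i hi =>
    Function.update_of_ne (by rintro rfl; exact hv hi) _ _
  have : Function.update ω v s ∈ E ↔ ω ∈ E :=
    ⟨hE _ _ h, hE _ _ fun i hi => (h i hi).symm⟩
  classical
  simp [Set.indicator_apply, this]

/-- A family of conditional distributions: `f v` depends on `v` and its parents only, and is
normalized in the coordinate `v`. -/
structure IsConditionalFamily {V : Type*} [DecidableEq V] {S : V → Type*}
    [∀ v, Fintype (S v)] (r : V → V → Prop) (f : V → (∀ v, S v) → ℝ) : Prop where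
  congr : ∀ v (ω ω' : ∀ v, S v), (∀ i, (i = v ∨ r i v) → ω i = ω' i) → f v ω = f v ω'
  sum_update : ∀ v ω, ∑ s, f v (Function.update ω v s) = 1

theorem IsConditionalFamily.mono {V : Type*} [DecidableEq V] {S : V → Type*}
    [∀ v, Fintype (S v)] {r r' : V → V → Prop} {f : V → (∀ v, S v) → ℝ}
    (hf : IsConditionalFamily r f) (h : ∀ a b, r a b → r' a b) : IsConditionalFamily r' f :=
  ⟨fun v ω ω' hω => hf.congr v ω ω' fun i hi => hω i (hi.imp_right (h _ _)), hf.sum_update⟩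

/-! ### Marginalization and conditional independence for products of conditional distributions -/

section Families

variable {V : Type*} [Fintype V] [DecidableEq V] {S : V → Type*} [∀ v, Fintype (S v)]
  {r : V → V → Prop} {f : V → (∀ v, S v) → ℝ}

theorem sum_sum_update (v : V) (h : (∀ v, S v) → ℝ) :
    ∑ ω, ∑ s, h (Function.update ω v s) = Fintype.card (S v) * ∑ ω, h ω := by
  rw [← (Equiv.piSplitAt v S).symm.sum_comp, ← (Equiv.piSplitAt v S).symm.sum_comp h,
    Fintype.sum_prod_type, Fintype.sum_prod_type]
  have : ∀ (t : S v) (q : ∀ j : {j // j ≠ v}, S j) (s : S v),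
      Function.update ((Equiv.piSplitAt v S).symm (t, q)) v s =
        (Equiv.piSplitAt v S).symm (s, q) := by
    intro t q s
    funext j
    by_cases hj : j = v
    · subst hj
      simp [Equiv.piSplitAt]
    · simp [Equiv.piSplitAt, hj]
  simp only [this, sum_const, card_univ, nsmul_eq_mul]
  rw [sum_comm]

/-- Summing out a coordinate on which only one, normalized, factor depends. -/
theorem sum_mul_eq_sum_mul_inv_card (v : V) (F h : (∀ v, S v) → ℝ)
    (hF : ∀ ω s, F (Function.update ω v s) = F ω)
    (hh : ∀ ω, ∑ s, h (Function.update ω v s) = 1) :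
    ∑ ω, F ω * h ω = ∑ ω, F ω * (Fintype.card (S v) : ℝ)⁻¹ := by
  rcases isEmpty_or_nonempty (∀ v, S v) with hΩ | ⟨⟨ω₀⟩⟩
  · simp
  have : Nonempty (S v) := ⟨ω₀ v⟩
  have hcard : (Fintype.card (S v) : ℝ) ≠ 0 := by simp
  have := sum_sum_update v fun ω => F ω * h ω
  simp only [hF, ← mul_sum, hh, mul_one] at this
  rw [← sum_mul, this]
  field_simp

/-- The family in which the factors of the nodes in `C` are replaced by uniform ones. -/
noncomputable def uniformize (f : V → (∀ v, S v) → ℝ) (C : Finset V) (v : V)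
    (ω : ∀ v, S v) : ℝ :=
  if v ∈ C then (Fintype.card (S v) : ℝ)⁻¹ else f v ω

/-- Marginalization to an ancestral set. -/
theorem sum_mul_prod_uniformize (hr : ∀ v, ¬ Relation.TransGen r v v)
    (hf : IsConditionalFamily r f) (C : Finset V) (hC : ∀ a b, r a b → a ∈ C → b ∈ C)
    (g : (∀ v, S v) → ℝ) (hg : ∀ v ∈ C, ∀ ω s, g (Function.update ω v s) = g ω) :
    ∑ ω, g ω * ∏ v, uniformize f C v ω = ∑ ω, g ω * ∏ v, f v ω := by
  induction hn : C.card generalizing C with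
  | zero =>
    obtain rfl := card_eq_zero.1 hn
    simp [uniformize]
  | succ n ih =>
    have hne : (C : Set V).Nonempty := by
      rw [coe_nonempty, ← card_pos]
      lia
    have : Std.Irrefl (Relation.TransGen r) := ⟨hr⟩
    -- A node with no ancestor in `C`: removing it keeps `C` closed under children. Its children lie
    -- in `C` and have uniform factors, so the only factor involving the coordinate `m` is its own.
    obtain ⟨m, hm, hmin⟩ :=
      (Finite.wellFounded_of_trans_of_irrefl (Relation.TransGen r)).has_min (C : Set V) hne
    rw [← ih (C.erase m) ?_ ?_ (by rw [card_erase_of_mem hm, hn]; rfl)]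
    · have split : ∀ (C' : Finset V) ω, g ω * ∏ v, uniformize f C' v ω =
          (g ω * ∏ v ∈ univ.erase m, uniformize f C' v ω) * uniformize f C' m ω := by
        intro C' ω
        rw [mul_assoc, prod_erase_mul _ _ (mem_univ m)]
      simp only [split]
      have h₁ : ∀ ω, uniformize f (C.erase m) m ω = f m ω := by simp [uniformize]
      have h₂ : ∀ ω, uniformize f C m ω = (Fintype.card (S m) : ℝ)⁻¹ := by
        intro ω
        simp [uniformize, mem_coe.1 hm]
      have h₃ : ∀ ω, ∏ v ∈ univ.erase m, uniformize f (C.erase m) v ω =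
          ∏ v ∈ univ.erase m, uniformize f C v ω := fun ω =>
        prod_congr rfl fun v hv => by simp [uniformize, ne_of_mem_erase hv]
      simp only [h₁, h₂, h₃]
      refine (sum_mul_eq_sum_mul_inv_card m _ _ (fun ω s => ?_) (hf.sum_update m)).symm
      rw [hg m hm]
      congr 1
      refine prod_congr rfl fun v hv => ?_
      unfold uniformize
      split_ifs with hvC
      · rfl
      · refine hf.congr v _ _ fun i hi => Function.update_of_ne ?_ _ _
        rintro rfl
        rcases hi with rfl | hi
        · exact hvC hm
        · exact hvC (hC _ _ hi hm)
    · intro a b hab ha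
      refine mem_erase.2 ⟨?_, hC a b hab (mem_of_mem_erase ha)⟩
      rintro rfl
      exact hmin a (mem_of_mem_erase ha) (.single hab)
    · exact fun v hv => hg v (mem_of_mem_erase hv)

theorem eventWeight_uniformize (hr : ∀ v, ¬ Relation.TransGen r v v)
    (hf : IsConditionalFamily r f) (C : Finset V) (hC : ∀ a b, r a b → a ∈ C → b ∈ C)
    {E : Set (∀ v, S v)} (hE : DependsOnNodes E (C : Set V)ᶜ) :
    eventWeight (fun ω => ∏ v, uniformize f C v ω) E =
      eventWeight (fun ω => ∏ v, f v ω) E := by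
  simp only [eventWeight_eq_sum_mul]
  exact sum_mul_prod_uniformize hr hf C hC _ fun v hv ω s =>
    indicator_update_eq hE (by simpa using hv) ω s

/-- The probability of an event about an ancestral set depends only on the factors there. -/
theorem eventWeight_congr_of_ancestral (hr : ∀ v, ¬ Relation.TransGen r v v)
    {f' : V → (∀ v, S v) → ℝ} (hf : IsConditionalFamily r f) (hf' : IsConditionalFamily r f')
    (C : Finset V) (hC : ∀ a b, r a b → a ∈ C → b ∈ C) (hff' : ∀ v ∉ C, f v = f' v)
    {E : Set (∀ v, S v)} (hE : DependsOnNodes E (C : Set V)ᶜ) :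
    eventWeight (fun ω => ∏ v, f v ω) E = eventWeight (fun ω => ∏ v, f' v ω) E := by
  rw [← eventWeight_uniformize hr hf C hC hE, ← eventWeight_uniformize hr hf' C hC hE]
  have : uniformize f C = uniformize f' C := by
    funext v ω
    unfold uniformize
    split_ifs with h
    · rfl
    · rw [hff' v h]
  rw [this]

/-- With all factors uniform the total is a product of terms n · n⁻¹, each 1, or 0 for an empty
state space. The inequality is all that the Fréchet lower bound needs. -/
theorem eventWeight_univ_le_one (hr : ∀ v, ¬ Relation.TransGen r v v)
    (hf : IsConditionalFamily r f) : eventWeight (fun ω => ∏ v, f v ω) Set.univ ≤ 1 := by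
  rw [← eventWeight_uniformize hr hf univ (fun _ _ _ _ => mem_univ _)
    fun _ _ _ _ => Set.mem_univ _]
  simp only [eventWeight, uniformize, mem_univ, if_true, Set.indicator_univ, sum_const,
    card_univ, nsmul_eq_mul, Fintype.card_pi, Nat.cast_prod, ← prod_mul_distrib]
  exact prod_le_one (fun v _ => by positivity) fun v _ => mul_inv_le_one

open Classical in
/-- If the weight is invariant under exchanging the coordinates in `R` of two assignments that
agree on `Z`, then, given a value of `Z`, the coordinates in `R` are independent of the others. -/
theorem eventWeight_inter_mul {p : (∀ v, S v) → ℝ} {R : Set V} {Z : Finset V}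
    (hRZ : ∀ v ∈ Z, v ∉ R)
    (hp : ∀ ω ω', (∀ v ∈ Z, ω v = ω' v) →
      p (R.piecewise ω' ω) * p (R.piecewise ω ω') = p ω * p ω')
    {E A B : Set (∀ v, S v)} (hE : DependsOnNodes E Z)
    (hE' : ∀ ω ∈ E, ∀ ω' ∈ E, ∀ v ∈ Z, ω v = ω' v)
    (hA : DependsOnNodes A R) (hB : DependsOnNodes B Rᶜ) :
    eventWeight p (B ∩ E) * eventWeight p (A ∩ E) =
      eventWeight p (A ∩ B ∩ E) * eventWeight p E := by
  simp only [eventWeight, sum_mul_sum]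
  rw [← Fintype.sum_prod_type', ← Fintype.sum_prod_type']
  -- Exchanging the `R`-coordinates moves the event `A` from the second assignment to the first,
  -- where `B` already is.
  let φ : (∀ v, S v) × (∀ v, S v) → (∀ v, S v) × (∀ v, S v) := fun q =>
    (R.piecewise q.2 q.1, R.piecewise q.1 q.2)
  have hφ : Function.Involutive φ := by
    rintro ⟨ω, ω'⟩
    simp only [φ, Prod.mk.injEq]
    constructor <;> funext v <;> by_cases hv : v ∈ R <;> simp [hv]
  refine Fintype.sum_equiv hφ.toPerm _ _ ?_
  rintro ⟨ω, ω'⟩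
  simp only [Function.Involutive.coe_toPerm, φ]
  have onR : ∀ a b : ∀ v, S v, ∀ v ∈ R, R.piecewise a b v = a v := fun a b v hv => by simp [hv]
  have offR : ∀ a b : ∀ v, S v, ∀ v ∈ Rᶜ, R.piecewise a b v = b v := fun a b v hv => by
    simp [Set.notMem_of_mem_compl hv]
  have iff_of : ∀ {D : Set (∀ v, S v)} {K : Set V}, DependsOnNodes D K →
      ∀ {a b : ∀ v, S v}, (∀ v ∈ K, a v = b v) → (a ∈ D ↔ b ∈ D) :=
    fun hD _ _ h => ⟨hD _ _ h, hD _ _ fun v hv => (h v hv).symm⟩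
  have e₁ := iff_of hE (a := R.piecewise ω' ω) (b := ω) fun v hv => offR _ _ v (hRZ v hv)
  have e₂ := iff_of hE (a := R.piecewise ω ω') (b := ω') fun v hv => offR _ _ v (hRZ v hv)
  have e₃ := iff_of hA (onR ω' ω)
  have e₄ := iff_of hB (offR ω' ω)
  simp only [Set.indicator_apply, Set.mem_inter_iff, e₁, e₂, e₃, e₄]
  by_cases h : ω ∈ E ∧ ω' ∈ E
  · have := hp ω ω' (hE' ω h.1 ω' h.2)
    by_cases hA' : ω' ∈ A <;> by_cases hB' : ω ∈ B <;> simp [h.1, h.2, hA', hB', this]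
  · by_cases h₁ : ω ∈ E
    · have h₂ : ω' ∉ E := fun h₂ => h ⟨h₁, h₂⟩
      simp [h₂]
    · simp [h₁]

end Families

/-! ### The back-door adjustment -/

namespace CausalModel

variable {V : Type*} {G : Digraph V} {S : V → Type*} [∀ v, Fintype (S v)]

theorem factor_congr (M : CausalModel G S) (v : V) {ω ω' : ∀ v, S v}
    (h : ∀ i, (i = v ∨ G.Adj i v) → ω i = ω' i) : M.factor v ω = M.factor v ω' := by
  have h₁ : (fun u : {u // G.Adj u v} => ω u) = fun u : {u // G.Adj u v} => ω' u :=
    funext fun u => h u (.inr u.2)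
  simp only [factor, h₁, h v (.inl rfl)]

theorem factor_nonneg (M : CausalModel G S) (v : V) (ω : ∀ v, S v) : 0 ≤ M.factor v ω :=
  M.cpt_nonneg _ _ _

theorem joint_nonneg [Fintype V] (M : CausalModel G S) (ω : ∀ v, S v) : 0 ≤ M.joint ω :=
  prod_nonneg fun v _ => M.factor_nonneg v ω

variable [DecidableEq V]

theorem sum_factor_update (M : CausalModel G S) {v : V} (hv : ¬ G.Adj v v) (ω : ∀ v, S v) :
    ∑ s, M.factor v (Function.update ω v s) = 1 := by
  rw [← M.cpt_sum v fun u => ω u]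
  refine sum_congr rfl fun s _ => ?_
  have h : (fun u : {u // G.Adj u v} => Function.update ω v s u) = fun u : {u // G.Adj u v} => ω u :=
    funext fun u => Function.update_of_ne (fun h => hv (by simpa only [h] using u.2)) _ _
  simp only [factor, h, Function.update_self]

theorem isConditionalFamily_factor (M : CausalModel G S) (hG : G.IsAcyclicDigraph) :
    IsConditionalFamily G.Adj M.factor :=
  ⟨fun v _ _ h => M.factor_congr v h, fun v => M.sum_factor_update fun h => hG v (.single h)⟩

/-- The factors of the model in which the children of `X` see the constant value `x` in place
of `X`. -/
def severedFactor (M : CausalModel G S) (X : V) (x : S X) (v : V) (ω : ∀ v, S v) : ℝ :=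
  if v = X then M.factor v ω else M.factor v (Function.update ω X x)

theorem isConditionalFamily_severedFactor (M : CausalModel G S) (hG : G.IsAcyclicDigraph)
    (X : V) (x : S X) :
    IsConditionalFamily (fun a b => G.Adj a b ∧ a ≠ X) (M.severedFactor X x) where
  congr v ω ω' h := by
    unfold severedFactor
    split_ifs with hv
    · subst hv
      refine M.factor_congr v fun i hi => h i (hi.imp_right fun hi => ⟨hi, ?_⟩)
      rintro rfl
      exact hG _ (.single hi)
    · refine M.factor_congr v fun i hi => ?_
      by_cases hiX : i = X
      · subst hiX
        simp
      · rw [Function.update_of_ne hiX, Function.update_of_ne hiX]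
        exact h i (hi.imp_right fun hi => ⟨hi, hiX⟩)
  sum_update v ω := by
    unfold severedFactor
    have hv : ¬ G.Adj v v := fun h => hG v (.single h)
    split_ifs with hvX
    · exact M.sum_factor_update hv ω
    · simp only [Function.update_comm hvX]
      exact M.sum_factor_update hv _

open Classical in
/-- The factors of the post-intervention distribution, as conditional distributions. -/
noncomputable def doFactor (M : CausalModel G S) (X : V) (x : S X) (v : V) (ω : ∀ v, S v) : ℝ :=
  if v = X then (if ω X = x then 1 else 0) else M.severedFactor X x v ω

theorem isConditionalFamily_doFactor (M : CausalModel G S) (hG : G.IsAcyclicDigraph)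
    (X : V) (x : S X) :
    IsConditionalFamily (fun a b => G.Adj a b ∧ a ≠ X) (M.doFactor X x) where
  congr v ω ω' h := by
    unfold doFactor
    split_ifs with hv h₁ h₂ h₂
    · rfl
    · subst hv
      exact (h₂ (h v (.inl rfl) ▸ h₁)).elim
    · subst hv
      exact (h₁ (h v (.inl rfl) ▸ h₂)).elim
    · rfl
    · exact (M.isConditionalFamily_severedFactor hG X x).congr v ω ω' h
  sum_update v ω := by
    unfold doFactor
    split_ifs with hv
    · subst hv
      have h : ∀ s, Function.update ω v s v = s := fun s => Function.update_self v s ω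
      rw [sum_eq_single x (fun s _ hs => if_neg fun h' => hs ((h s).symm.trans h')) (by simp),
        if_pos (h x)]
    · exact (M.isConditionalFamily_severedFactor hG X x).sum_update v ω

variable [Fintype V]

theorem doJoint_nonneg (M : CausalModel G S) (X : V) (x : S X) (ω : ∀ v, S v) :
    0 ≤ M.doJoint X x ω :=
  Set.indicator_nonneg (fun ω _ => prod_nonneg fun v _ => M.factor_nonneg v ω) ω

theorem doJoint_eq_prod (M : CausalModel G S) (X : V) (x : S X) (ω : ∀ v, S v) :
    M.doJoint X x ω = ∏ v, M.doFactor X x v ω := by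
  classical
  rw [doJoint, ← mul_prod_erase _ _ (mem_univ X), Set.indicator_apply]
  by_cases h : ω X = x
  · subst h
    simp only [Set.mem_ofPred_eq, if_true, doFactor, one_mul]
    refine prod_congr rfl fun v hv => ?_
    simp [severedFactor, ne_of_mem_erase hv]
  · simp [h, doFactor]

/-- An event that does not involve `X` has the same probability after the intervention and in
the severed model. -/
theorem eventWeight_doJoint (M : CausalModel G S) (hG : G.IsAcyclicDigraph) (X : V) (x : S X)
    {E : Set (∀ v, S v)} (hE : DependsOnNodes E {X}ᶜ) :
    eventWeight (M.doJoint X x) E =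
      eventWeight (fun ω => ∏ v, M.severedFactor X x v ω) E := by
  have : M.doJoint X x = fun ω => ∏ v, M.doFactor X x v ω := funext (M.doJoint_eq_prod X x)
  rw [this]
  refine eventWeight_congr_of_ancestral (r := fun a b => G.Adj a b ∧ a ≠ X) ?_
    (M.isConditionalFamily_doFactor hG X x) (M.isConditionalFamily_severedFactor hG X x) {X}
    ?_ ?_ (by simpa using hE)
  · exact fun v h => hG v (h.lift id fun _ _ h => h.1)
  · intro a b h ha
    exact (h.2 (mem_singleton.1 ha)).elim
  · intro v hv
    funext ω
    simp [doFactor, mem_singleton.not.1 hv]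

/-- The severed model agrees with the observational distribution where `X = x`. -/
theorem eventWeight_joint_inter (M : CausalModel G S) (X : V) (x : S X) (E : Set (∀ v, S v)) :
    eventWeight M.joint ({ω | ω X = x} ∩ E) =
      eventWeight (fun ω => ∏ v, M.severedFactor X x v ω) ({ω | ω X = x} ∩ E) := by
  refine sum_congr rfl fun ω _ => ?_
  by_cases h : ω ∈ {ω | ω X = x} ∩ E
  · rw [Set.indicator_of_mem h, Set.indicator_of_mem h]
    obtain ⟨rfl, -⟩ := h
    exact prod_congr rfl fun v _ => by simp [severedFactor]
  · rw [Set.indicator_of_notMem h, Set.indicator_of_notMem h]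

/-- The severed model agrees with the observational distribution on the nondescendants of
`X`. -/
theorem eventWeight_joint_of_nondescendant (M : CausalModel G S) (hG : G.IsAcyclicDigraph)
    (X : V) (x : S X) {E : Set (∀ v, S v)} (hE : DependsOnNodes E {v | ¬ G.IsDescendant X v}) :
    eventWeight M.joint E = eventWeight (fun ω => ∏ v, M.severedFactor X x v ω) E := by
  classical
  refine eventWeight_congr_of_ancestral hG (M.isConditionalFamily_factor hG)
    ((M.isConditionalFamily_severedFactor hG X x).mono fun _ _ h => h.1)
    (univ.filter (G.IsDescendant X)) ?_ ?_ (hE.mono fun v hv => by simpa using hv)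
  · intro a b hab ha
    simp only [mem_filter, mem_univ, true_and] at ha ⊢
    exact ha.tail hab
  · intro v hv
    simp only [mem_filter, mem_univ, true_and] at hv
    funext ω
    unfold severedFactor
    split_ifs with hvX
    · rfl
    · refine M.factor_congr v fun i hi => (Function.update_of_ne ?_ _ _).symm
      rintro rfl
      rcases hi with rfl | hi
      · exact hv .refl
      · exact hv (.single hi)

/-- In the severed model, `X` and `Y` are independent given `Z`. -/
theorem eventWeight_severed_mul (M : CausalModel G S) (hG : G.IsAcyclicDigraph) {X Y : V}
    (hXY : X ≠ Y) {Z : Finset V} (hZ : G.BackDoor X Y Z) (x : S X) (y : S Y)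
    {E : Set (∀ v, S v)} (hE : DependsOnNodes E Z)
    (hE' : ∀ ω ∈ E, ∀ ω' ∈ E, ∀ v ∈ Z, ω v = ω' v) :
    eventWeight (fun ω => ∏ v, M.severedFactor X x v ω) ({ω | ω Y = y} ∩ E) *
        eventWeight (fun ω => ∏ v, M.severedFactor X x v ω) ({ω | ω X = x} ∩ E) =
      eventWeight (fun ω => ∏ v, M.severedFactor X x v ω)
          ({ω | ω X = x} ∩ {ω | ω Y = y} ∩ E) *
        eventWeight (fun ω => ∏ v, M.severedFactor X x v ω) E := by
  classical
  set r : V → V → Prop := fun a b => G.Adj a b ∧ a ≠ X with hr_def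
  have hr : ∀ v, ¬ Relation.TransGen r v v := fun v h => hG v (h.lift id fun _ _ h => h.1)
  have hf : IsConditionalFamily r (M.severedFactor X x) :=
    M.isConditionalFamily_severedFactor hG X x
  -- The ancestral set of `X`, `Y` and `Z`. All events concerned depend on it only, so the factors
  -- outside it may be made uniform.
  set A : Set V := {v | HasDescendantIn r Z v ∨ Relation.ReflTransGen r v X ∨
    Relation.ReflTransGen r v Y}
  set C : Finset V := univ.filter (· ∉ A)
  have hC : ∀ a b, r a b → a ∈ C → b ∈ C := by
    intro a b hab ha
    simp only [C, mem_filter, mem_univ, true_and] at ha ⊢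
    rintro (h | h | h)
    · exact ha (.inl (h.of_reflTransGen (.single hab)))
    · exact ha (.inr (.inl (h.head hab)))
    · exact ha (.inr (.inr (h.head hab)))
  have hCA : (C : Set V)ᶜ = A := by
    ext v
    simp [C]
  have hX' : DependsOnNodes {ω : ∀ v, S v | ω X = x} (C : Set V)ᶜ :=
    dependsOnNodes_eval x (hCA ▸ .inr (.inl .refl))
  have hY' : DependsOnNodes {ω : ∀ v, S v | ω Y = y} (C : Set V)ᶜ :=
    dependsOnNodes_eval y (hCA ▸ .inr (.inr .refl))
  have hE'' : DependsOnNodes E (C : Set V)ᶜ :=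
    hE.mono fun v hv => hCA ▸ .inl (.of_mem hv)
  rw [← eventWeight_uniformize hr hf C hC (hY'.inter hE''),
    ← eventWeight_uniformize hr hf C hC (hX'.inter hE''),
    ← eventWeight_uniformize hr hf C hC ((hX'.inter hY').inter hE''),
    ← eventWeight_uniformize hr hf C hC hE'']
  have hYr : ∀ m, ¬ ActiveReach r Z X Y m := hZ.not_activeReach hG hXY
  refine eventWeight_inter_mul (R := activeSet r Z X) (fun v hv h => h.1 hv) ?_ hE hE'
    (dependsOnNodes_eval x ⟨fun h => hZ.not_descendant X h .refl, _, .start⟩)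
    (dependsOnNodes_eval y fun h => h.2.elim hYr)
  intro ω ω' hω
  rw [← prod_mul_distrib, ← prod_mul_distrib]
  refine prod_congr rfl fun v _ => ?_
  unfold uniformize
  split_ifs with hv
  · rfl
  have hvA : v ∈ A := by simpa [C] using hv
  -- If the family lies in the reached set and `Z`, the two factors trade places; if it misses the
  -- reached set, both are unchanged.
  rcases family_subset_or_disjoint_activeSet hYr hvA with h | h
  · have key : ∀ a b : ∀ v, S v, (∀ v ∈ Z, a v = b v) →
        M.severedFactor X x v ((activeSet r Z X).piecewise a b) = M.severedFactor X x v a := by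
      intro a b hab
      refine hf.congr v _ _ fun i hi => ?_
      by_cases hiR : i ∈ activeSet r Z X
      · simp [hiR]
      · simp [hiR, hab i ((h i hi).resolve_left hiR)]
    rw [key ω' ω fun v hv => (hω v hv).symm, key ω ω' hω, mul_comm]
  · have key : ∀ a b : ∀ v, S v,
        M.severedFactor X x v ((activeSet r Z X).piecewise a b) = M.severedFactor X x v b :=
      fun a b => hf.congr v _ _ fun i hi => by simp [h i hi]
    rw [key, key]

/-- An intervention on `X` does not change the distribution of the back-door set. -/
theorem doProb_eq_prob (M : CausalModel G S) (hG : G.IsAcyclicDigraph) {X Y : V}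
    {Z : Finset V} (hZ : G.BackDoor X Y Z) (x : S X)
    {E : Set (∀ v, S v)} (hE : DependsOnNodes E Z) : M.doProb X x E = M.prob E := by
  refine (M.eventWeight_doJoint hG X x (hE.mono ?_)).trans
    (M.eventWeight_joint_of_nondescendant hG X x (hE.mono hZ.not_descendant)).symm
  rintro v hv rfl
  exact hZ.not_descendant v hv .refl

/-- The back-door adjustment for a single value of the back-door set, without division. -/
theorem doProb_mul_prob (M : CausalModel G S) (hG : G.IsAcyclicDigraph) {X Y : V}
    (hXY : X ≠ Y) {Z : Finset V} (hZ : G.BackDoor X Y Z) (x : S X) (y : S Y)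
    {E : Set (∀ v, S v)} (hE : DependsOnNodes E Z)
    (hE' : ∀ ω ∈ E, ∀ ω' ∈ E, ∀ v ∈ Z, ω v = ω' v) :
    M.doProb X x ({ω | ω Y = y} ∩ E) * M.prob ({ω | ω X = x} ∩ E) =
      M.prob ({ω | ω X = x} ∩ {ω | ω Y = y} ∩ E) * M.prob E := by
  have hE'' : DependsOnNodes ({ω | ω Y = y} ∩ E) {X}ᶜ := by
    refine (dependsOnNodes_eval y hXY.symm).inter (hE.mono ?_)
    rintro v hv rfl
    exact hZ.not_descendant v hv .refl
  have h := M.eventWeight_severed_mul hG hXY hZ x y hE hE'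
  -- Only the weight of `Y = y` with `E` becomes interventional; the other three events fix `X = x`
  -- or concern nondescendants of `X`, so their weights are observational.
  rw [← M.eventWeight_doJoint hG X x hE'', ← M.eventWeight_joint_inter,
    ← M.eventWeight_joint_of_nondescendant hG X x (hE.mono hZ.not_descendant), Set.inter_assoc,
    ← M.eventWeight_joint_inter, ← Set.inter_assoc] at h
  exact h

end CausalModel

/-! ### The optimization problem -/

/-- As 0 ≤ a ≤ c, every term is at most b, also when c = 0 and the quotient is 0 by convention. The
b's sum to the total mass of the table. -/
theorem IsFeasible.objective_mem_Icc {𝒳 𝒴 𝒲 𝒰 : Type*} [Fintype 𝒳] [Fintype 𝒴] [Fintype 𝒲]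
    [Fintype 𝒰] {q : 𝒳 → 𝒴 → 𝒲 → ℝ} {r : 𝒰 → ℝ} {x : 𝒳} {y : 𝒴} {a b c : 𝒲 → 𝒰 → ℝ}
    (h : IsFeasible q r x y a b c) :
    ∑ w, ∑ u, a w u * b w u / c w u ∈ Set.Icc 0 (∑ w, ∑ x', ∑ y', q x' y' w) := by
  have ha : ∀ w u, 0 ≤ a w u := fun w u => (le_max_left _ _).trans (h.le_a w u)
  have hb : ∀ w u, 0 ≤ b w u := fun w u => (le_max_left _ _).trans (h.le_b w u)
  have hc : ∀ w u, 0 ≤ c w u := fun w u => (le_max_left _ _).trans (h.le_c w u)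
  constructor
  · exact sum_nonneg fun w _ => sum_nonneg fun u _ =>
      div_nonneg (mul_nonneg (ha w u) (hb w u)) (hc w u)
  · refine sum_le_sum fun w _ => ?_
    rw [← h.sum_b w]
    refine sum_le_sum fun u _ => div_le_of_le_mul₀ (hc w u) (hb w u) ?_
    rw [mul_comm]
    exact mul_le_mul_of_nonneg_left (h.a_le_c w u) (hb w u)

/-! ### The true probabilities as a feasible point -/

namespace CausalModel

variable {V : Type*} [Fintype V] [DecidableEq V] {G : Digraph V} {S : V → Type*}
  [∀ v, Fintype (S v)]

theorem prob_mono (M : CausalModel G S) {E F : Set (∀ v, S v)} (h : E ⊆ F) :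
    M.prob E ≤ M.prob F :=
  eventWeight_mono M.joint_nonneg h

theorem prob_nonneg (M : CausalModel G S) (E : Set (∀ v, S v)) : 0 ≤ M.prob E :=
  eventWeight_nonneg M.joint_nonneg E

theorem sum_prob_inter (M : CausalModel G S) {ι : Type*} [Fintype ι] (E : Set (∀ v, S v))
    (g : (∀ v, S v) → ι) : ∑ i, M.prob (E ∩ {ω | g ω = i}) = M.prob E :=
  sum_eventWeight_inter E g

theorem sum_tableXYW (M : CausalModel G S) (X Y : V) (W : Finset V) (x : S X)
    (w : ∀ v : W, S v) :
    ∑ y, M.tableXYW X Y W x y w = M.prob ({ω | ω X = x} ∩ {ω | W.restrict ω = w}) := by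
  rw [← M.sum_prob_inter _ fun ω => ω Y]
  refine sum_congr rfl fun y _ => congrArg M.prob ?_
  ext ω
  simp only [Set.mem_inter_iff, Set.mem_ofPred_eq]
  tauto

theorem sum_sum_tableXYW (M : CausalModel G S) (X Y : V) (W : Finset V) (w : ∀ v : W, S v) :
    ∑ x, ∑ y, M.tableXYW X Y W x y w = M.prob {ω | W.restrict ω = w} := by
  rw [← M.sum_prob_inter _ fun ω => ω X]
  simp only [sum_tableXYW, Set.inter_comm]

/-- The true joint probabilities are a feasible point. -/
theorem isFeasible_prob (M : CausalModel G S) (hG : G.IsAcyclicDigraph) (X Y : V)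
    (W U : Finset V) (x : S X) (y : S Y) :
    IsFeasible (M.tableXYW X Y W) (M.tableU U) x y
      (fun w u => M.prob ({ω | ω X = x ∧ ω Y = y ∧ W.restrict ω = w} ∩ {ω | U.restrict ω = u}))
      (fun w u => M.prob ({ω | W.restrict ω = w} ∩ {ω | U.restrict ω = u}))
      (fun w u =>
        M.prob ({ω | ω X = x} ∩ {ω | W.restrict ω = w} ∩ {ω | U.restrict ω = u})) := by
  have hlow : ∀ E F, max 0 (M.prob E + M.prob F - 1) ≤ M.prob (E ∩ F) :=
    le_eventWeight_inter M.joint_nonneg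
      (eventWeight_univ_le_one hG (M.isConditionalFamily_factor hG))
  have hupp : ∀ E F, M.prob (E ∩ F) ≤ min (M.prob E) (M.prob F) :=
    eventWeight_inter_le M.joint_nonneg
  constructor
  case sum_a => exact fun w => M.sum_prob_inter _ _
  case sum_b =>
    intro w
    rw [sum_sum_tableXYW]
    exact M.sum_prob_inter _ _
  case sum_c =>
    intro w
    rw [sum_tableXYW]
    exact M.sum_prob_inter _ _
  case c_le_b => exact fun w u => M.prob_mono fun ω h => ⟨h.1.2, h.2⟩
  case a_le_c => exact fun w u => M.prob_mono fun ω h => ⟨⟨h.1.1, h.1.2.2⟩, h.2⟩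
  -- The six remaining constraints are the Fréchet bounds.
  all_goals
    try simp only [sum_sum_tableXYW]
    try simp only [sum_tableXYW]
    first | exact fun w u => hlow _ _ | exact fun w u => hupp _ _

/-- The back-door adjustment formula. -/
theorem sum_adjustment_eq_causalEffect (M : CausalModel G S) (hG : G.IsAcyclicDigraph) {X Y : V}
    (hXY : X ≠ Y) {W U : Finset V} (hZ : G.BackDoor X Y (W ∪ U)) (x : S X) (y : S Y)
    (hpos : ∀ (w : ∀ v : W, S v) (u : ∀ v : U, S v),
      0 < M.prob ({ω | W.restrict ω = w} ∩ {ω | U.restrict ω = u}) →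
        0 < M.prob ({ω | ω X = x} ∩ {ω | W.restrict ω = w} ∩ {ω | U.restrict ω = u})) :
    ∑ w : (∀ v : W, S v), ∑ u : (∀ v : U, S v),
      M.prob ({ω | ω X = x ∧ ω Y = y ∧ W.restrict ω = w} ∩ {ω | U.restrict ω = u}) *
        M.prob ({ω | W.restrict ω = w} ∩ {ω | U.restrict ω = u}) /
        M.prob ({ω | ω X = x} ∩ {ω | W.restrict ω = w} ∩ {ω | U.restrict ω = u}) =
      M.causalEffect X Y x y := by
  have hsum : ∀ (E : Set (∀ v, S v)), M.doProb X x E =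
      ∑ w : (∀ v : W, S v), ∑ u : (∀ v : U, S v),
        M.doProb X x (E ∩ ({ω | W.restrict ω = w} ∩ {ω | U.restrict ω = u})) := by
    intro E
    have h₁ := sum_eventWeight_inter (p := M.doJoint X x) E W.restrict
    rw [doProb, ← eventWeight, ← h₁]
    refine sum_congr rfl fun w _ => ?_
    rw [← sum_eventWeight_inter (p := M.doJoint X x) _ U.restrict]
    simp only [Set.inter_assoc]
    rfl
  rw [causalEffect, hsum]
  refine sum_congr rfl fun w _ => sum_congr rfl fun u _ => ?_
  set E : Set (∀ v, S v) := {ω | W.restrict ω = w} ∩ {ω | U.restrict ω = u} with hE_def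
  have hE : DependsOnNodes E (W ∪ U : Finset V) := by
    rintro ω ω' hω ⟨rfl, rfl⟩
    exact ⟨funext fun v => (hω v (by simp)).symm, funext fun v => (hω v (by simp)).symm⟩
  have hE' : ∀ ω ∈ E, ∀ ω' ∈ E, ∀ v ∈ W ∪ U, ω v = ω' v := by
    rintro ω ⟨h₁, h₂⟩ ω' ⟨h₁', h₂'⟩ v hv
    rcases mem_union.1 hv with hv | hv
    · exact congrFun (h₁.trans h₁'.symm) ⟨v, hv⟩
    · exact congrFun (h₂.trans h₂'.symm) ⟨v, hv⟩
  have ha : ({ω | ω X = x ∧ ω Y = y ∧ W.restrict ω = w} ∩ {ω | U.restrict ω = u} :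
      Set (∀ v, S v)) = {ω | ω X = x} ∩ {ω | ω Y = y} ∩ E := by
    ext ω
    simp only [hE_def, Set.mem_inter_iff, Set.mem_ofPred_eq]
    tauto
  have hpos' := hpos w u
  rw [Set.inter_assoc, ← hE_def] at hpos'
  rw [ha, Set.inter_assoc {ω | ω X = x} {ω | W.restrict ω = w}, ← hE_def]
  -- If P(w,u) = 0, then P(w,u | do(x)) = 0 as well, because the intervention does not affect the
  -- back-door set; both sides vanish.
  rcases (M.prob_nonneg E).eq_or_lt with h₀ | h₀
  · rw [← h₀, mul_zero, zero_div]
    refine le_antisymm (eventWeight_nonneg (M.doJoint_nonneg X x) _) ?_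
    rw [h₀, ← M.doProb_eq_prob hG hZ x hE]
    exact eventWeight_mono (M.doJoint_nonneg X x) Set.inter_subset_right
  · rw [div_eq_iff (hpos' h₀).ne']
    exact (M.doProb_mul_prob hG hXY hZ x y hE hE').symm

end CausalModel

theorem theorem1 {V : Type*} [Fintype V] [DecidableEq V] (G : Digraph V)
    (hG : G.IsAcyclicDigraph) (S : V → Type*) [∀ v, Fintype (S v)] (M : CausalModel G S)
    (X Y : V) (hXY : X ≠ Y) (W U : Finset V) (hZ : G.BackDoor X Y (W ∪ U))
    (x : S X) (y : S Y)
    (hpos : ∀ (w : ∀ v : W, S v) (u : ∀ v : U, S v),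
      0 < M.prob {ω | W.restrict ω = w ∧ U.restrict ω = u} →
        0 < M.prob {ω | ω X = x ∧ W.restrict ω = w ∧ U.restrict ω = u}) :
    (objectiveValues (M.tableXYW X Y W) (M.tableU U) x y).Nonempty ∧
    BddBelow (objectiveValues (M.tableXYW X Y W) (M.tableU U) x y) ∧
    BddAbove (objectiveValues (M.tableXYW X Y W) (M.tableU U) x y) ∧
    sInf (objectiveValues (M.tableXYW X Y W) (M.tableU U) x y) ≤ M.causalEffect X Y x y ∧
    M.causalEffect X Y x y ≤ sSup (objectiveValues (M.tableXYW X Y W) (M.tableU U) x y) := by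
  have hpos' : ∀ (w : ∀ v : W, S v) (u : ∀ v : U, S v),
      0 < M.prob ({ω | W.restrict ω = w} ∩ {ω | U.restrict ω = u}) →
        0 < M.prob ({ω | ω X = x} ∩ {ω | W.restrict ω = w} ∩ {ω | U.restrict ω = u}) := by
    intro w u h
    rw [Set.inter_assoc]
    exact hpos w u h
  have hmem : M.causalEffect X Y x y ∈
      objectiveValues (M.tableXYW X Y W) (M.tableU U) x y := by
    -- Positivity is what makes the objective defined at the true point: P(x,w,u) = 0 forces P(w,u)
    -- = 0.
    refine ⟨_, _, _, M.isFeasible_prob hG X Y W U x y, fun w u hc => ?_,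
      (M.sum_adjustment_eq_causalEffect hG hXY hZ x y hpos').symm⟩
    by_contra hb
    exact (hpos' w u ((M.prob_nonneg _).lt_of_ne' hb)).ne' hc
  have hbelow : BddBelow (objectiveValues (M.tableXYW X Y W) (M.tableU U) x y) := by
    refine ⟨0, ?_⟩
    rintro t ⟨a, b, c, h, -, rfl⟩
    exact h.objective_mem_Icc.1
  have habove : BddAbove (objectiveValues (M.tableXYW X Y W) (M.tableU U) x y) := by
    refine ⟨∑ w, ∑ x', ∑ y', M.tableXYW X Y W x' y' w, ?_⟩
    rintro t ⟨a, b, c, h, -, rfl⟩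
    exact h.objective_mem_Icc.2
  exact ⟨⟨_, hmem⟩, hbelow, habove, csInf_le hbelow hmem, le_csSup habove hmem⟩
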